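/- Let $n\ge 1$ and $N=2n$. Let $Q$ be the probability measure on the symmetric group $\mathcal S_N$ with $Q(\mathrm{id})=1/N$, $Q(\sigma)=2/N^2$ for every transposition $\sigma$, and $Q(\sigma)=0$ otherwise. Let $H=\mathcal S_n\times\mathcal S_n\le\mathcal S_N$ be the subgroup of permutations that permute the first $n$ and the last $n$ positions among themselves, and let $X=\mathcal S_N/H$ be the set of left cosets of $H$ (the arrangements of a deck of $n$ red and $n$ black cards). Random transpositions on red/black decks is the Markov chain on $X$ with transition matrix $K(xH,yH)=\sum_{h\in H}Q(yhx^{-1})$; let $\Pi$ be the uniform distribution on $X$. (1) The eigenvalues of $K$, acting on the complex-valued functions on $X$ by $Kf(x)=\sum_y K(x,y)f(y)$, are exactly $\beta_0=1$ and $$\beta_j=\frac1N+\frac{(N-j)^2-(N-j)+j^2-3j}{N^2},\qquad j=1,\dots,n.$$ The eigenvalue $1$ has multiplicity $1$, and for $1\le j\le n$ the eigenspace of $\beta_j$ has dimension $m_j=\binom Nj-\binom N{j-1}$. (2) There is a universal constant $A$ such that for all $n\ge1$, all real $c$, every integer $l\ge0$ with $l\ge\frac14N(\log N+c)$ and every starting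 state $x\in X$, $$\|K^l(x,\cdot)-\Pi\|_{TV}=\frac12\sum_{y\in X}|K^l(x,y)-\Pi(y)|\le A\,e^{-c/2}.$$ -/

import Mathlib

namespace RedBlack

/-- The measure on the permutations of `N` positions driving the random transposition walk:
mass `1 / N` at the identity, `2 / N ^ 2` at each transposition, and `0` elsewhere. -/
noncomputable def transpositionMeasure (N : ℕ) (σ : Equiv.Perm (Fin N)) : ℝ :=
  open scoped Classical in
  if σ = 1 then 1 / (N : ℝ) else if σ.IsSwap then 2 / (N : ℝ) ^ 2 else 0

/-- The transition matrix `K(x, y) = Q(y H x⁻¹)` of the quotient on the left cosets `G ⧸ H` of the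
left random walk on `G` driven by `Q`. The set `y H x⁻¹` consists of the `g` with `g • x = y`. -/
noncomputable def quotientWalk {G : Type*} [Group G] [Fintype G] (H : Subgroup G) (Q : G → ℝ) :
    Matrix (G ⧸ H) (G ⧸ H) ℝ :=
  open scoped Classical in
  fun x y => ∑ g : G with g • x = y, Q g

/-- In terms of coset representatives, `K(xH, yH) = ∑ h ∈ H, Q(y h x⁻¹)`. -/
theorem quotientWalk_mk {G : Type*} [Group G] [Fintype G] (H : Subgroup G) [Fintype H]
    (Q : G → ℝ) (x y : G) :
    quotientWalk H Q (x : G ⧸ H) (y : G ⧸ H) = ∑ h : H, Q (y * h * x⁻¹) := by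
  classical
  unfold quotientWalk
  symm
  refine Finset.sum_bij (fun h _ => y * h * x⁻¹) ?_ ?_ ?_ ?_
  · intro h _
    refine Finset.mem_filter.2 ⟨Finset.mem_univ _, ?_⟩
    change ((y * h * x⁻¹ * x : G) : G ⧸ H) = (y : G ⧸ H)
    rw [inv_mul_cancel_right, QuotientGroup.mk_mul_of_mem _ h.2]
  · intro a _ b _ hab
    simpa using hab
  · intro g hg
    have hg' : ((g * x : G) : G ⧸ H) = (y : G ⧸ H) :=
      (Finset.mem_filter.1 hg).2
    refine ⟨⟨y⁻¹ * (g * x), QuotientGroup.eq.1 hg'.symm⟩, Finset.mem_univ _, ?_⟩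
    simp [mul_assoc]
  · intro h _
    rfl

/-- The Young subgroup `S_n × S_n` of `S_{2n}`: the permutations that permute the first `n`
positions among themselves and the last `n` positions among themselves. -/
def youngSubgroup (n : ℕ) : Subgroup (Equiv.Perm (Fin (2 * n))) where
  carrier := {σ | ∀ i, (σ i).val < n ↔ i.val < n}
  mul_mem' := fun {a b} ha hb i => (ha (b i)).trans (hb i)
  one_mem' := fun _ => Iff.rfl
  inv_mem' := fun {a} ha i => by
    have h := ha (a⁻¹ i)
    have e : a (a⁻¹ i) = i := Equiv.apply_symm_apply a i
    rw [e] at h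
    exact h.symm

/-- The space of arrangements of `n` indistinguishable red and `n` indistinguishable black cards,
as the coset space `S_{2n} / (S_n × S_n)`. -/
abbrev Deck (n : ℕ) : Type := Equiv.Perm (Fin (2 * n)) ⧸ youngSubgroup n

noncomputable instance (n : ℕ) : DecidablePred (· ∈ youngSubgroup n) := Classical.decPred _

/-- The Markov chain of random transpositions on red/black decks of `N = 2n` cards. -/
noncomputable def chain (n : ℕ) : Matrix (Deck n) (Deck n) ℝ :=
  quotientWalk (youngSubgroup n) (transpositionMeasure (2 * n))

/-- The chain as an operator on complex-valued functions, `K f (x) = ∑ y, K(x, y) f(y)`. -/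
noncomputable def chainOperator (n : ℕ) : Module.End ℂ (Deck n → ℂ) :=
  Matrix.toLin' ((chain n).map Complex.ofReal)

/-- `β_j = 1/N + ((N - j)² - (N - j) + j² - 3j) / N²` with `N = 2n`. -/
noncomputable def eigenvalue (n j : ℕ) : ℝ :=
  let N : ℝ := 2 * n
  1 / N + ((N - j) ^ 2 - (N - j) + (j : ℝ) ^ 2 - 3 * j) / N ^ 2

/-- The uniform distribution on a finite set. -/
noncomputable def uniform (X : Type*) [Fintype X] (_ : X) : ℝ := 1 / (Fintype.card X : ℝ)

/-- Total variation distance of two probability vectors on a finite set. -/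
noncomputable def tvDist {X : Type*} [Fintype X] (μ ν : X → ℝ) : ℝ :=
  1 / 2 * ∑ x, |μ x - ν x|

end RedBlack

/-! # Random transpositions on red/black decks

An arrangement is determined by the set of positions of its red cards, so a function of arrangements
is a function of the `n`-subsets of the `N = 2n` positions. As `Q` is the law of the transposition
of two independent uniform positions (trivial if they coincide), one step of the chain keeps the
set or exchanges a point of it with a point of its complement.

*Spectrum.* On functions of subsets let `down` sum over the supersets with one more element and `up`
over the subsets with one element less. Then `down * up - up * down` is the scalar `N - 2k` on
functions of `k`-subsets (`down_up_eq`), and `N² K = 2 * up * down + 2n² - 2n` on functions of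
`n`-subsets (`up_down_deckExtend`). Since `up * down` on `(k+1)`-subsets and `down * up` on
`k`-subsets have isomorphic eigenspaces away from `0`, the spectrum of `up * down` on `(k+1)`-subsets
is that on `k`-subsets shifted by `N - 2k`, with the new eigenvalue `0` of multiplicity
`C(N, k+1) - C(N, k)`; induction on `k` gives all eigenvalues with the dimensions of their
eigenspaces (`levelEigenspace_spectrum`).

*Convergence.* The dimensions add up to the number of arrangements, so `K` is diagonalizable and
`tr K ^ m = ∑ m_j β_j ^ m` (`trace_chain_pow`). The chain is symmetric and commutes with the
transitive action of the symmetric group, so the diagonal of `K ^ (2l)` is constant, and the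
Cauchy-Schwarz inequality gives `4 ‖K ^ l (x, ·) - Π‖² ≤ ∑_{j ≥ 1} m_j β_j ^ (2l)`
(`four_mul_tvDist_sq_le`). With `β_j = 1 - 2 j (N - j + 1) / N² ≤ exp (-2 j (N - j + 1) / N²)` and
`m_j ≤ N ^ j / j!`, the `j`-th term is at most `e ^ (-c) N ^ (j (j - 1) / N) / j!` for `c ≥ 0`. As
`log x / x` decreases for `x ≥ e`, this is at most `e ^ (-c) (2j) ^ ((j - 1) / 2) / j!`, which is
summable over `j` with a bound independent of `n`. For `c < 0` the trivial bound `1` suffices. -/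

namespace RedBlack

open Finset Module

/-! ### The up and down operators on functions of subsets -/

theorem extendByZero_injective (𝕜 : Type*) [Field 𝕜] {ι β : Type*} {φ : ι → β} (hφ : φ.Injective) :
    Function.Injective (Function.ExtendByZero.linearMap 𝕜 φ) := fun f g hfg => by
  ext i
  simpa [hφ.extend_apply] using congrFun hfg (φ i)

/-- The functions on subsets of `α` that vanish off the subsets of cardinality `k`. -/
def level (𝕜 α : Type*) [Field 𝕜] (k : ℕ) : Submodule 𝕜 (Finset α → 𝕜) where
  carrier := {f | ∀ s, s.card ≠ k → f s = 0}
  add_mem' hf hg s hs := by simp [hf s hs, hg s hs]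
  zero_mem' _ _ := rfl
  smul_mem' c f hf s hs := by simp [hf s hs]

/-- If `φ` enumerates the `k`-subsets, extension by zero along `φ` maps onto the functions on
`k`-subsets. -/
theorem range_extendByZero (𝕜 : Type*) [Field 𝕜] {ι α : Type*} {φ : ι → Finset α}
    (hφ : φ.Injective) {k : ℕ} (h : ∀ s, s.card = k ↔ s ∈ Set.range φ) :
    LinearMap.range (Function.ExtendByZero.linearMap 𝕜 φ) = level 𝕜 α k := by
  ext f
  constructor
  · rintro ⟨g, rfl⟩ s hs
    exact Function.extend_apply' _ _ _ (fun hs' => hs ((h s).2 hs'))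
  · intro hf
    refine ⟨f ∘ φ, ?_⟩
    ext s
    by_cases hs : s ∈ Set.range φ
    · obtain ⟨i, rfl⟩ := hs
      exact hφ.extend_apply _ _ _
    · rw [hf s (fun hs' => hs ((h s).1 hs'))]
      exact Function.extend_apply' _ _ _ hs

theorem finrank_level {𝕜 α : Type*} [Field 𝕜] [Fintype α] (k : ℕ) :
    finrank 𝕜 (level 𝕜 α k) = (Fintype.card α).choose k := by
  rw [← range_extendByZero 𝕜 (φ := (Subtype.val : {s : Finset α // s.card = k} → Finset α))
    Subtype.val_injective (by simp), LinearMap.finrank_range_of_inj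
    (extendByZero_injective 𝕜 Subtype.val_injective), Module.finrank_fintype_fun_eq_card,
    Fintype.card_finset_len]

/-- The operator on functions of subsets that sums over the subsets with one element less. -/
def up (𝕜 α : Type*) [Field 𝕜] [DecidableEq α] : End 𝕜 (Finset α → 𝕜) where
  toFun f s := ∑ b ∈ s, f (s.erase b)
  map_add' f g := by ext s; simp [sum_add_distrib]
  map_smul' c f := by ext s; simp [mul_sum]

theorem up_mem_level {𝕜 α : Type*} [Field 𝕜] [DecidableEq α] {k : ℕ} {f : Finset α → 𝕜}
    (hf : f ∈ level 𝕜 α k) :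
    up 𝕜 α f ∈ level 𝕜 α (k + 1) := fun s hs =>
  sum_eq_zero fun b hb => hf _ (by
    rw [card_erase_of_mem hb]
    have := card_pos.2 ⟨b, hb⟩
    omega)

section Boolean

variable (𝕜 : Type*) [Field 𝕜] (α : Type*) [Fintype α] [DecidableEq α]

/-- The operator on functions of subsets that sums over the supersets with one more element. -/
def down : End 𝕜 (Finset α → 𝕜) where
  toFun f s := ∑ a ∈ sᶜ, f (insert a s)
  map_add' f g := by ext s; simp [sum_add_distrib]
  map_smul' c f := by ext s; simp [mul_sum]

/-- The operator on functions of subsets that sums over all exchanges of one element of the set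
with one element of its complement. -/
def exchange : End 𝕜 (Finset α → 𝕜) where
  toFun f s := ∑ b ∈ s, ∑ a ∈ sᶜ, f (insert a (s.erase b))
  map_add' f g := by ext s; simp [sum_add_distrib]
  map_smul' c f := by ext s; simp [mul_sum]

/-- The eigenspace of `up * down` among the functions on `k`-subsets. -/
def levelEigenspace (k : ℕ) (μ : 𝕜) : Submodule 𝕜 (Finset α → 𝕜) :=
  level 𝕜 α k ⊓ End.eigenspace (up 𝕜 α * down 𝕜 α) μ

variable {𝕜 α}

theorem mem_levelEigenspace {k : ℕ} {μ : 𝕜} {f : Finset α → 𝕜} :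
    f ∈ levelEigenspace 𝕜 α k μ ↔ f ∈ level 𝕜 α k ∧ up 𝕜 α (down 𝕜 α f) = μ • f := by
  simp [levelEigenspace]

theorem up_down_apply (f : Finset α → 𝕜) (s : Finset α) :
    up 𝕜 α (down 𝕜 α f) s = s.card * f s + exchange 𝕜 α f s := by
  change ∑ b ∈ s, ∑ a ∈ (s.erase b)ᶜ, f (insert a (s.erase b)) =
    _ + ∑ b ∈ s, ∑ a ∈ sᶜ, f (insert a (s.erase b))
  rw [← nsmul_eq_mul, ← sum_const, ← sum_add_distrib]
  refine sum_congr rfl fun b hb => ?_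
  rw [compl_erase, sum_insert (by simpa using hb), insert_erase hb]

theorem down_up_apply (f : Finset α → 𝕜) (s : Finset α) :
    down 𝕜 α (up 𝕜 α f) s = sᶜ.card * f s + exchange 𝕜 α f s := by
  change ∑ a ∈ sᶜ, ∑ b ∈ insert a s, f ((insert a s).erase b) =
    _ + ∑ b ∈ s, ∑ a ∈ sᶜ, f (insert a (s.erase b))
  rw [← nsmul_eq_mul, ← sum_const, sum_comm (s := s), ← sum_add_distrib]
  refine sum_congr rfl fun a ha => ?_
  have ha' : a ∉ s := by simpa using ha
  rw [sum_insert ha', erase_insert ha']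
  congr 1
  refine sum_congr rfl fun b hb => ?_
  rw [erase_insert_of_ne (by rintro rfl; exact ha' hb)]

theorem down_mem_level {k : ℕ} {f : Finset α → 𝕜} (hf : f ∈ level 𝕜 α (k + 1)) :
    down 𝕜 α f ∈ level 𝕜 α k := fun s hs =>
  sum_eq_zero fun a ha => hf _ (by rw [card_insert_of_notMem (by simpa using ha)]; omega)

theorem exchange_mem_level {k : ℕ} {f : Finset α → 𝕜} (hf : f ∈ level 𝕜 α k) :
    exchange 𝕜 α f ∈ level 𝕜 α k := fun s hs =>
  sum_eq_zero fun b hb => sum_eq_zero fun a ha => hf _ (by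
    rw [card_insert_of_notMem (by simp at ha ⊢; tauto), card_erase_of_mem hb]
    have := card_pos.2 ⟨b, hb⟩
    omega)

theorem up_down_mem_level {k : ℕ} {f : Finset α → 𝕜} (hf : f ∈ level 𝕜 α k) :
    up 𝕜 α (down 𝕜 α f) ∈ level 𝕜 α k := fun s hs => by
  rw [up_down_apply, hf s hs, exchange_mem_level hf s hs, mul_zero, add_zero]

/-- The commutation relation of `sl₂`: the commutator of `down` and `up` is the scalar `N - 2k` on
functions of `k`-subsets. -/
theorem down_up_eq {k : ℕ} {f : Finset α → 𝕜} (hf : f ∈ level 𝕜 α k) :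
    down 𝕜 α (up 𝕜 α f) = up 𝕜 α (down 𝕜 α f) + ((Fintype.card α : 𝕜) - 2 * k) • f := by
  ext s
  simp only [Pi.add_apply, Pi.smul_apply, smul_eq_mul, up_down_apply, down_up_apply]
  by_cases hs : s.card = k
  · have h : (s.card : 𝕜) + (sᶜ.card : 𝕜) = Fintype.card α := by
      exact_mod_cast congrArg (Nat.cast (R := 𝕜)) (card_add_card_compl s)
    rw [← h, hs]
    ring
  · rw [hf s hs]
    ring

/-- Summing over all ordered pairs of positions, a transposition fixes a set unless it exchanges a
point inside with a point outside. -/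
theorem sum_sum_image_swap (f : Finset α → 𝕜) (s : Finset α) :
    ∑ a, ∑ b, f (s.image (Equiv.swap a b)) =
      ((s.card : 𝕜) ^ 2 + (sᶜ.card : 𝕜) ^ 2) * f s + 2 * exchange 𝕜 α f s := by
  have h1 : ∀ a ∈ s, ∀ b ∈ s, s.image (Equiv.swap a b) = s := fun a ha b hb => by
    ext x
    simp only [mem_image, Equiv.swap_apply_def]
    grind
  have h2 : ∀ a ∈ sᶜ, ∀ b ∈ sᶜ, s.image (Equiv.swap a b) = s := fun a ha b hb => by
    ext x
    simp only [mem_compl] at ha hb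
    simp only [mem_image, Equiv.swap_apply_def]
    grind
  have h3 : ∀ b ∈ s, ∀ a ∈ sᶜ, s.image (Equiv.swap b a) = insert a (s.erase b) :=
      fun b hb a ha => by
    ext x
    simp only [mem_compl] at ha
    simp only [mem_image, Equiv.swap_apply_def, mem_insert, mem_erase]
    grind
  have h4 : ∀ a ∈ s, ∑ b ∈ s, f (s.image (Equiv.swap a b)) = s.card * f s := fun a ha => by
    rw [sum_congr rfl fun b hb => by rw [h1 a ha b hb], sum_const, nsmul_eq_mul]
  have h5 : ∀ a ∈ sᶜ, ∑ b ∈ sᶜ, f (s.image (Equiv.swap a b)) = sᶜ.card * f s := fun a ha => by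
    rw [sum_congr rfl fun b hb => by rw [h2 a ha b hb], sum_const, nsmul_eq_mul]
  have h6 : ∑ b ∈ s, ∑ a ∈ sᶜ, f (s.image (Equiv.swap b a)) = exchange 𝕜 α f s :=
    sum_congr rfl fun b hb => sum_congr rfl fun a ha => by rw [h3 b hb a ha]
  have h7 : ∑ a ∈ sᶜ, ∑ b ∈ s, f (s.image (Equiv.swap a b)) = exchange 𝕜 α f s := by
    rw [sum_comm, ← h6]
    simp only [Equiv.swap_comm]
  rw [← sum_add_sum_compl s]
  simp only [← sum_add_sum_compl s (fun b => f (s.image (Equiv.swap _ b)))]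
  rw [sum_add_distrib, sum_add_distrib, sum_congr rfl h4, sum_congr rfl h5, h6, h7, sum_const,
    sum_const, nsmul_eq_mul, nsmul_eq_mul]
  ring

/-! ### The spectrum on functions of `k`-subsets -/

theorem down_mem_levelEigenspace {k : ℕ} {μ : 𝕜} {f : Finset α → 𝕜}
    (hf : f ∈ levelEigenspace 𝕜 α (k + 1) (μ + ((Fintype.card α : 𝕜) - 2 * k))) :
    down 𝕜 α f ∈ levelEigenspace 𝕜 α k μ := by
  rw [mem_levelEigenspace] at hf ⊢
  have h := down_mem_level hf.1
  refine ⟨h, ?_⟩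
  have h2 := down_up_eq h
  rw [hf.2, map_smul, add_smul] at h2
  exact (add_right_cancel h2).symm

theorem up_mem_levelEigenspace {k : ℕ} {μ : 𝕜} {f : Finset α → 𝕜}
    (hf : f ∈ levelEigenspace 𝕜 α k μ) :
    up 𝕜 α f ∈ levelEigenspace 𝕜 α (k + 1) (μ + ((Fintype.card α : 𝕜) - 2 * k)) := by
  rw [mem_levelEigenspace] at hf ⊢
  refine ⟨up_mem_level hf.1, ?_⟩
  rw [down_up_eq hf.1, hf.2, ← add_smul, map_smul]

/-- Away from the eigenvalue `0`, the spectrum of `up * down` on `(k+1)`-subsets is that on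
`k`-subsets shifted by `N - 2k`: `down` and `up` are inverse to each other up to a scalar. -/
theorem finrank_levelEigenspace_succ {k : ℕ} {μ : 𝕜}
    (hμ : μ + ((Fintype.card α : 𝕜) - 2 * k) ≠ 0) :
    finrank 𝕜 (levelEigenspace 𝕜 α (k + 1) (μ + ((Fintype.card α : 𝕜) - 2 * k))) =
      finrank 𝕜 (levelEigenspace 𝕜 α k μ) := by
  apply le_antisymm
  · refine LinearMap.finrank_le_finrank_of_injective
      (f := (down 𝕜 α).restrict fun f hf => down_mem_levelEigenspace hf) ?_
    rw [← LinearMap.ker_eq_bot, LinearMap.ker_eq_bot']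
    rintro ⟨f, hf⟩ h
    have h0 : down 𝕜 α f = 0 := congrArg Subtype.val h
    have h1 := (mem_levelEigenspace.1 hf).2
    rw [h0, map_zero] at h1
    exact Subtype.ext ((smul_eq_zero.1 h1.symm).resolve_left hμ)
  · refine LinearMap.finrank_le_finrank_of_injective
      (f := (up 𝕜 α).restrict fun f hf => up_mem_levelEigenspace hf) ?_
    rw [← LinearMap.ker_eq_bot, LinearMap.ker_eq_bot']
    rintro ⟨f, hf⟩ h
    have h0 : up 𝕜 α f = 0 := congrArg Subtype.val h
    have h2 := mem_levelEigenspace.1 hf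
    have h1 := down_up_eq h2.1
    rw [h0, map_zero, h2.2, ← add_smul] at h1
    exact Subtype.ext ((smul_eq_zero.1 h1.symm).resolve_left hμ)

/-- If `down * up` is injective on `k`-subsets, then `down` is onto there, and the kernel of
`up * down` on `(k+1)`-subsets is that of `down`. -/
theorem finrank_levelEigenspace_succ_zero {k : ℕ}
    (h : levelEigenspace 𝕜 α k (-((Fintype.card α : 𝕜) - 2 * k)) = ⊥) :
    finrank 𝕜 (levelEigenspace 𝕜 α (k + 1) 0) + (Fintype.card α).choose k =
      (Fintype.card α).choose (k + 1) := by
  set D : level 𝕜 α (k + 1) →ₗ[𝕜] level 𝕜 α k :=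
    (down 𝕜 α).restrict fun f hf => down_mem_level hf with hD
  set U : level 𝕜 α k →ₗ[𝕜] level 𝕜 α (k + 1) :=
    (up 𝕜 α).restrict fun f hf => up_mem_level hf with hU
  have hDU : Function.Injective (D ∘ₗ U) := by
    rw [← LinearMap.ker_eq_bot, LinearMap.ker_eq_bot']
    rintro ⟨f, hf⟩ h0
    have h1 : down 𝕜 α (up 𝕜 α f) = 0 := congrArg Subtype.val h0
    rw [down_up_eq hf] at h1
    have h2 : f ∈ levelEigenspace 𝕜 α k (-((Fintype.card α : 𝕜) - 2 * k)) :=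
      mem_levelEigenspace.2 ⟨hf, by rw [neg_smul]; exact eq_neg_of_add_eq_zero_left h1⟩
    rw [h] at h2
    exact Subtype.ext h2
  have hsurj : Function.Surjective D := fun g =>
    let ⟨f, hf⟩ := LinearMap.injective_iff_surjective.1 hDU g
    ⟨U f, hf⟩
  have hker : (LinearMap.ker D).map (level 𝕜 α (k + 1)).subtype =
      levelEigenspace 𝕜 α (k + 1) 0 := by
    ext f
    rw [mem_levelEigenspace, zero_smul]
    constructor
    · rintro ⟨⟨g, hg⟩, h0, rfl⟩
      have h1 : down 𝕜 α g = 0 := congrArg Subtype.val h0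
      exact ⟨hg, by simp [h1]⟩
    · rintro ⟨hf, h0⟩
      refine ⟨⟨f, hf⟩, ?_, rfl⟩
      have hU0 : Function.Injective U := Function.Injective.of_comp (f := D) hDU
      refine hU0 (Subtype.ext ?_)
      rw [map_zero]
      exact h0
  have h1 := LinearMap.finrank_range_add_finrank_ker D
  rw [LinearMap.range_eq_top.2 hsurj, finrank_top, finrank_level, finrank_level] at h1
  rw [← hker, ((level 𝕜 α (k + 1)).equivSubtypeMap (LinearMap.ker D)).symm.finrank_eq, ← h1,
    add_comm]

variable (𝕜) in
/-- The eigenvalue `(k - j)(N - k - j + 1)` of `up * down` on functions of `k`-subsets of a set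
with `N` elements. -/
def levelEigenvalue (N k j : ℕ) : 𝕜 := ((k : 𝕜) - j) * (N - k - j + 1)

theorem levelEigenvalue_succ (N k j : ℕ) :
    levelEigenvalue 𝕜 N (k + 1) j = levelEigenvalue 𝕜 N k j + (N - 2 * k) := by
  simp only [levelEigenvalue]
  push_cast
  ring

theorem levelEigenvalue_self (N k : ℕ) : levelEigenvalue 𝕜 N k k = 0 := by
  simp [levelEigenvalue]

theorem levelEigenvalue_eq_natCast {N k j : ℕ} (hj : j ≤ k) (hk : 2 * k ≤ N) :
    levelEigenvalue 𝕜 N k j = (((k - j) * (N - k - j + 1) : ℕ) : 𝕜) := by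
  push_cast [levelEigenvalue, Nat.cast_sub hj, Nat.cast_sub (by omega : k ≤ N),
    Nat.cast_sub (by omega : j ≤ N - k)]
  rfl

/-- The multiplicity `C(N, j) - C(N, j - 1)`, with `C(N, -1) = 0`. The subtraction of natural
numbers does not truncate for `2 * j ≤ N`. -/
def multiplicity (N : ℕ) : ℕ → ℕ
  | 0 => 1
  | j + 1 => N.choose (j + 1) - N.choose j

variable [CharZero 𝕜]

theorem levelEigenvalue_ne_neg {N k j : ℕ} (hj : j ≤ k) (hk : 2 * k < N) :
    levelEigenvalue 𝕜 N k j ≠ -((N : 𝕜) - 2 * k) := by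
  intro h
  rw [levelEigenvalue_eq_natCast hj hk.le, eq_neg_iff_add_eq_zero] at h
  have h1 : ((N : 𝕜) - 2 * k) = ((N - 2 * k : ℕ) : 𝕜) := by push_cast [Nat.cast_sub hk.le]; rfl
  rw [h1, ← Nat.cast_add, Nat.cast_eq_zero] at h
  omega

/-- The spectrum of `up * down` on functions of `k`-subsets, `2k ≤ N`, with multiplicities. -/
theorem levelEigenspace_spectrum (k : ℕ) (hk : 2 * k ≤ Fintype.card α) :
    (∀ j ≤ k, finrank 𝕜 (levelEigenspace 𝕜 α k (levelEigenvalue 𝕜 (Fintype.card α) k j)) =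
      multiplicity (Fintype.card α) j) ∧
    ∀ μ : 𝕜, levelEigenspace 𝕜 α k μ ≠ ⊥ →
      ∃ j ≤ k, μ = levelEigenvalue 𝕜 (Fintype.card α) k j := by
  induction k with
  | zero =>
    have h0 : ∀ f ∈ level 𝕜 α 0, up 𝕜 α (down 𝕜 α f) = 0 := fun f hf => by
      ext s
      by_cases hs : s.card = 0
      · rw [card_eq_zero.1 hs]; rfl
      · exact up_down_mem_level hf s hs
    refine ⟨fun j hj => ?_, fun μ hμ => ⟨0, le_rfl, ?_⟩⟩
    · obtain rfl : j = 0 := by omega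
      have : levelEigenspace 𝕜 α 0 (0 : 𝕜) = level 𝕜 α 0 := by
        ext f
        rw [mem_levelEigenspace, zero_smul]
        exact ⟨fun h => h.1, fun h => ⟨h, h0 f h⟩⟩
      rw [levelEigenvalue_self, this, finrank_level, Nat.choose_zero_right]
      rfl
    · obtain ⟨f, hf, hne⟩ := Submodule.exists_mem_ne_zero_of_ne_bot hμ
      rw [mem_levelEigenspace] at hf
      rw [h0 f hf.1] at hf
      rw [levelEigenvalue_self]
      exact (smul_eq_zero.1 hf.2.symm).resolve_right hne
  | succ k ih =>
    obtain ⟨ih1, ih2⟩ := ih (by omega)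
    constructor
    · intro j hj
      rcases Nat.lt_or_eq_of_le hj with hj | rfl
      · rw [← ih1 j (by omega), levelEigenvalue_succ]
        refine finrank_levelEigenspace_succ ?_
        rw [Ne, add_eq_zero_iff_eq_neg]
        exact levelEigenvalue_ne_neg (by omega) (by omega)
      · rw [levelEigenvalue_self]
        -- All eigenvalues of `up * down` on `k`-subsets are at least `0`, so `-(N - 2k)` is none.
        have h := finrank_levelEigenspace_succ_zero (𝕜 := 𝕜) (α := α) (k := k) (by
          by_contra hne
          obtain ⟨j, hj, h⟩ := ih2 _ hne
          exact levelEigenvalue_ne_neg hj (by omega) h.symm)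
        change _ = (Fintype.card α).choose (k + 1) - (Fintype.card α).choose k
        omega
    · intro μ hμ
      by_cases h0 : μ = 0
      · exact ⟨k + 1, le_rfl, by rw [h0, levelEigenvalue_self]⟩
      · obtain ⟨ν, rfl⟩ : ∃ ν, μ = ν + ((Fintype.card α : 𝕜) - 2 * k) :=
          ⟨μ - ((Fintype.card α : 𝕜) - 2 * k), by ring⟩
        obtain ⟨j, hj, rfl⟩ := ih2 ν (by
          rw [Ne, ← Submodule.finrank_eq_zero, ← finrank_levelEigenspace_succ h0,
            Submodule.finrank_eq_zero]
          exact hμ)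
        exact ⟨j, by omega, (levelEigenvalue_succ _ _ _).symm⟩

end Boolean

/-! ### The chain as an operator on functions of `n`-subsets -/

/-- `Q` is the law of the transposition of two independent uniform positions. -/
theorem transpositionMeasure_eq_card (N : ℕ) (g : Equiv.Perm (Fin N)) :
    transpositionMeasure N g =
      (#{p : Fin N × Fin N | Equiv.swap p.1 p.2 = g} : ℝ) / (N : ℝ) ^ 2 := by
  classical
  unfold transpositionMeasure
  split_ifs with h1 h2
  · subst h1
    have : ({p : Fin N × Fin N | Equiv.swap p.1 p.2 = 1} : Finset _) =
        univ.image fun a => (a, a) := by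
      ext ⟨a, b⟩
      simp [Equiv.swap_eq_one_iff]
    rw [this, card_image_of_injective _ fun a b h => congrArg Prod.fst h, card_univ,
      Fintype.card_fin]
    rcases eq_or_ne (N : ℝ) 0 with h | h
    · simp [h]
    · field_simp
  · obtain ⟨a, b, hab, rfl⟩ := h2
    have : ({p : Fin N × Fin N | Equiv.swap p.1 p.2 = Equiv.swap a b} : Finset _) =
        {(a, b), (b, a)} := by
      ext ⟨c, d⟩
      simp only [mem_filter, mem_univ, true_and, mem_insert, mem_singleton, Prod.mk.injEq]
      constructor
      · intro h
        have ha := congrArg (fun e : Equiv.Perm (Fin N) => e a) h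
        have hb := congrArg (fun e : Equiv.Perm (Fin N) => e b) h
        simp only [Equiv.swap_apply_def] at ha hb
        grind
      · rintro (⟨rfl, rfl⟩ | ⟨rfl, rfl⟩)
        · rfl
        · exact Equiv.swap_comm _ _
    rw [this, card_pair (by simp [hab])]
    norm_num
  · have : ({p : Fin N × Fin N | Equiv.swap p.1 p.2 = g} : Finset _) = ∅ := by
      refine filter_eq_empty_iff.2 ?_
      rintro ⟨a, b⟩ - rfl
      by_cases hab : a = b
      · exact h1 (Equiv.swap_eq_one_iff.2 hab)
      · exact h2 ⟨a, b, hab, rfl⟩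
    simp [this]

/-- One step of the chain applies the transposition of two independent uniform positions. -/
theorem chain_apply (n : ℕ) (x y : Deck n) :
    chain n x y = (#{p : Fin (2 * n) × Fin (2 * n) | Equiv.swap p.1 p.2 • x = y} : ℝ) /
      ((2 * n : ℕ) : ℝ) ^ 2 := by
  classical
  unfold chain quotientWalk
  simp only [transpositionMeasure_eq_card]
  rw [← sum_div, ← Nat.cast_sum]
  congr 2
  rw [card_eq_sum_card_fiberwise (f := fun p : Fin (2 * n) × Fin (2 * n) => Equiv.swap p.1 p.2)
    (t := {g | g • x = y}) (fun p hp => by simpa using hp)]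
  refine sum_congr rfl fun g hg => ?_
  congr 1
  ext p
  simp only [mem_filter, mem_univ, true_and] at hg ⊢
  exact ⟨fun h => ⟨h ▸ hg, h⟩, fun h => h.2⟩

theorem chain_nonneg (n : ℕ) (x y : Deck n) : 0 ≤ chain n x y := by
  rw [chain_apply]
  positivity

theorem chain_symm (n : ℕ) (x y : Deck n) : chain n x y = chain n y x := by
  rw [chain_apply, chain_apply]
  congr 3
  ext p
  rw [mem_filter, mem_filter, ← eq_inv_smul_iff, Equiv.swap_inv, eq_comm]

/-- The chain commutes with permutations of the positions, because conjugation permutes the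
transpositions. -/
theorem chain_smul (n : ℕ) (g : Equiv.Perm (Fin (2 * n))) (x y : Deck n) :
    chain n (g • x) (g • y) = chain n x y := by
  rw [chain_apply, chain_apply]
  congr 2
  symm
  refine card_equiv (g.prodCongr g) fun p => ?_
  simp only [mem_filter, mem_univ, true_and, Equiv.prodCongr_apply, Prod.map]
  rw [Equiv.swap_apply_apply, mul_smul, mul_smul, inv_smul_smul, smul_left_cancel_iff]

/-- The averaging form of the chain, over any field of characteristic zero to which `ℝ` maps. -/
theorem sum_chain_mul {R : Type*} [Field R] [CharZero R] (n : ℕ) (ι : ℝ →+* R) (x : Deck n)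
    (f : Deck n → R) :
    ∑ y, ι (chain n x y) * f y =
      (∑ a : Fin (2 * n), ∑ b : Fin (2 * n), f (Equiv.swap a b • x)) / ((2 * n : ℕ) : R) ^ 2 := by
  classical
  simp only [chain_apply, map_div₀, map_pow, map_natCast, div_mul_eq_mul_div]
  rw [← sum_div, ← Fintype.sum_prod_type'
    (f := fun a b : Fin (2 * n) => f (Equiv.swap a b • x))]
  congr 1
  rw [← sum_fiberwise_of_maps_to (g := fun p : Fin (2 * n) × Fin (2 * n) =>
    Equiv.swap p.1 p.2 • x) (t := univ) (fun _ _ => mem_univ _)]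
  refine sum_congr rfl fun y _ => ?_
  rw [sum_congr rfl (g := fun _ => f y) (fun p hp => by rw [(mem_filter.1 hp).2]), sum_const,
    nsmul_eq_mul]

theorem sum_chain {n : ℕ} (hn : 1 ≤ n) (x : Deck n) : ∑ y, chain n x y = 1 := by
  have h := sum_chain_mul n (RingHom.id ℝ) x fun _ => 1
  simp only [RingHom.id_apply, mul_one, sum_const, card_univ, Fintype.card_fin] at h
  rw [h]
  have : (n : ℝ) ≠ 0 := by positivity
  simp
  field_simp

/-- The set of positions of the red cards in an arrangement. -/
def redPositions (n : ℕ) (x : Deck n) : Finset (Fin (2 * n)) :=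
  Quotient.liftOn' x (fun g => ({i | i.val < n} : Finset (Fin (2 * n))).image g) (by
    intro g g' h
    rw [QuotientGroup.leftRel_apply] at h
    ext i
    simp only [mem_image, mem_filter, mem_univ, true_and]
    constructor
    · rintro ⟨j, hj, rfl⟩
      refine ⟨g'⁻¹ (g j), ?_, by simp⟩
      have := h (g'⁻¹ (g j))
      simp at this
      exact this.1 hj
    · rintro ⟨j, hj, rfl⟩
      exact ⟨(g⁻¹ * g') j, (h j).2 hj, by simp⟩)

theorem redPositions_mk (n : ℕ) (g : Equiv.Perm (Fin (2 * n))) :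
    redPositions n (g : Deck n) = ({i | i.val < n} : Finset (Fin (2 * n))).image g := rfl

theorem redPositions_smul (n : ℕ) (g : Equiv.Perm (Fin (2 * n))) (x : Deck n) :
    redPositions n (g • x) = (redPositions n x).image g := by
  induction x using QuotientGroup.induction_on with | H h => ?_
  rw [MulAction.Quotient.smul_coe, redPositions_mk, redPositions_mk, image_image]
  rfl

theorem redPositions_injective (n : ℕ) : (redPositions n).Injective := by
  intro x y
  induction x using QuotientGroup.induction_on with | H g => ?_
  induction y using QuotientGroup.induction_on with | H g' => ?_
  intro h
  rw [redPositions_mk, redPositions_mk] at h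
  refine QuotientGroup.eq.2 fun i => ?_
  have := congrArg (fun s => g' i ∈ s) h
  simp only [mem_image, mem_filter, mem_univ, true_and, EmbeddingLike.apply_eq_iff_eq,
    exists_eq_right, eq_iff_iff] at this
  rw [← this]
  constructor
  · intro hi
    exact ⟨_, hi, by simp⟩
  · rintro ⟨j, hj, hji⟩
    have : (g⁻¹ * g') i = j := by simp [← hji]
    rwa [this]

theorem card_filter_val_lt (n : ℕ) : #{i : Fin (2 * n) | i.val < n} = n := by
  rw [Fin.card_filter_val_lt]
  omega

theorem card_eq_iff_mem_range_redPositions (n : ℕ) (s : Finset (Fin (2 * n))) :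
    s.card = n ↔ s ∈ Set.range (redPositions n) := by
  constructor
  · intro hs
    have e : {i : Fin (2 * n) // i.val < n} ≃ {i // i ∈ s} := Fintype.equivOfCardEq (by
      rw [Fintype.card_subtype, card_filter_val_lt, Fintype.card_coe, hs])
    refine ⟨(e.extendSubtype : Equiv.Perm (Fin (2 * n))), ?_⟩
    rw [redPositions_mk]
    refine eq_of_subset_of_card_le (fun i hi => ?_) ?_
    · obtain ⟨j, hj, rfl⟩ := mem_image.1 hi
      exact e.extendSubtype_mem j (by simpa using hj)
    · rw [card_image_of_injective _ (Equiv.injective _), card_filter_val_lt, hs]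
  · rintro ⟨x, rfl⟩
    induction x using QuotientGroup.induction_on with | H g => ?_
    rw [redPositions_mk, card_image_of_injective _ (Equiv.injective _), card_filter_val_lt]

/-- A function of arrangements, as a function of `n`-subsets, extended by zero to all subsets. -/
noncomputable def deckExtend (n : ℕ) : (Deck n → ℂ) →ₗ[ℂ] (Finset (Fin (2 * n)) → ℂ) :=
  Function.ExtendByZero.linearMap ℂ (redPositions n)

theorem deckExtend_redPositions (n : ℕ) (f : Deck n → ℂ) (x : Deck n) :
    deckExtend n f (redPositions n x) = f x :=
  (redPositions_injective n).extend_apply _ _ _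

theorem deckExtend_injective (n : ℕ) : Function.Injective (deckExtend n) :=
  extendByZero_injective ℂ (redPositions_injective n)

theorem range_deckExtend (n : ℕ) :
    LinearMap.range (deckExtend n) = level ℂ (Fin (2 * n)) n :=
  range_extendByZero ℂ (redPositions_injective n) (card_eq_iff_mem_range_redPositions n)

theorem card_deck (n : ℕ) : Fintype.card (Deck n) = (2 * n).choose n := by
  rw [← Module.finrank_fintype_fun_eq_card ℂ,
    ← LinearMap.finrank_range_of_inj (deckExtend_injective n), range_deckExtend, finrank_level,
    Fintype.card_fin]

/-- On `n`-subsets the chain is `(2 * up * down + 2 * n ^ 2 - 2 * n) / N ^ 2`. -/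
theorem up_down_deckExtend {n : ℕ} (hn : 1 ≤ n) (f : Deck n → ℂ) :
    up ℂ (Fin (2 * n)) (down ℂ (Fin (2 * n)) (deckExtend n f)) =
      (2 * (n : ℂ) ^ 2) • deckExtend n (chainOperator n f) -
        ((n : ℂ) ^ 2 - n) • deckExtend n f := by
  have hmem : ∀ g, deckExtend n g ∈ level ℂ (Fin (2 * n)) n := fun g => by
    rw [← range_deckExtend]; exact ⟨g, rfl⟩
  ext s
  simp only [Pi.sub_apply, Pi.smul_apply, smul_eq_mul]
  by_cases hs : s.card = n
  · have hsc : sᶜ.card = n := by rw [card_compl, Fintype.card_fin, hs]; omega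
    obtain ⟨x, rfl⟩ := (card_eq_iff_mem_range_redPositions n s).1 hs
    have h1 := sum_sum_image_swap (deckExtend n f) (redPositions n x)
    simp only [← redPositions_smul, deckExtend_redPositions, hs, hsc] at h1
    have h2 : chainOperator n f x = _ := sum_chain_mul n Complex.ofRealHom x f
    rw [h1] at h2
    rw [deckExtend_redPositions, deckExtend_redPositions, up_down_apply, deckExtend_redPositions,
      h2, hs]
    have : (n : ℂ) ≠ 0 := by exact_mod_cast (by omega : n ≠ 0)
    push_cast
    field_simp
    ring
  · rw [up_down_mem_level (hmem f) s hs, hmem f s hs, hmem _ s hs]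
    ring

theorem finrank_eigenspace_chainOperator {n : ℕ} (hn : 1 ≤ n) (μ : ℂ) :
    finrank ℂ ((chainOperator n).eigenspace μ) =
      finrank ℂ (levelEigenspace ℂ (Fin (2 * n)) n (2 * n ^ 2 * μ - (n ^ 2 - n))) := by
  have hn0 : (2 * (n : ℂ) ^ 2) ≠ 0 := by
    have : (n : ℂ) ≠ 0 := by exact_mod_cast (by omega : n ≠ 0)
    simpa using this
  have key : ∀ f, up ℂ (Fin (2 * n)) (down ℂ (Fin (2 * n)) (deckExtend n f)) =
      (2 * (n : ℂ) ^ 2 * μ - (n ^ 2 - n)) • deckExtend n f ↔ chainOperator n f = μ • f := by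
    intro f
    rw [up_down_deckExtend hn, sub_smul (2 * (n : ℂ) ^ 2 * μ), sub_left_inj,
      mul_smul (_ * _), smul_right_inj hn0, ← map_smul, (deckExtend_injective n).eq_iff]
  suffices h : ((chainOperator n).eigenspace μ).map (deckExtend n) =
      levelEigenspace ℂ (Fin (2 * n)) n (2 * n ^ 2 * μ - (n ^ 2 - n)) by
    rw [← h]
    exact LinearEquiv.finrank_eq (Submodule.equivMapOfInjective _ (deckExtend_injective n) _)
  ext F
  rw [mem_levelEigenspace, ← range_deckExtend]
  constructor
  · rintro ⟨f, hf, rfl⟩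
    exact ⟨⟨f, rfl⟩, (key f).2 (End.mem_eigenspace_iff.1 hf)⟩
  · rintro ⟨⟨f, rfl⟩, hf⟩
    exact ⟨f, End.mem_eigenspace_iff.2 ((key f).1 hf), rfl⟩

/-- The affine relation between `up * down` and the chain carries the eigenvalues
`(n - j) * (n - j + 1)` to the numbers `β_j`. -/
theorem levelEigenvalue_eq_eigenvalue {n : ℕ} (hn : 1 ≤ n) (j : ℕ) :
    levelEigenvalue ℂ (2 * n) n j = 2 * n ^ 2 * (eigenvalue n j : ℂ) - (n ^ 2 - n) := by
  have : (n : ℂ) ≠ 0 := by exact_mod_cast (by omega : n ≠ 0)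
  simp only [levelEigenvalue, eigenvalue]
  push_cast
  field_simp
  ring

theorem eigenvalue_zero {n : ℕ} (hn : 1 ≤ n) : eigenvalue n 0 = 1 := by
  have : (n : ℝ) ≠ 0 := by exact_mod_cast (by omega : n ≠ 0)
  simp only [eigenvalue]
  push_cast
  field_simp
  ring

/-! ### Eigenvalues and multiplicities of the chain -/

theorem finrank_eigenspace_eigenvalue {n j : ℕ} (hn : 1 ≤ n) (hj : j ≤ n) :
    finrank ℂ ((chainOperator n).eigenspace (eigenvalue n j : ℂ)) = multiplicity (2 * n) j := by
  have h := (levelEigenspace_spectrum (𝕜 := ℂ) (α := Fin (2 * n)) n (by simp)).1 j hj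
  rw [Fintype.card_fin, levelEigenvalue_eq_eigenvalue hn] at h
  rw [finrank_eigenspace_chainOperator hn, h]

theorem choose_pred_lt {n j : ℕ} (hj : j + 1 ≤ n) :
    (2 * n).choose j < (2 * n).choose (j + 1) := by
  have h := Nat.choose_succ_right_eq (2 * n) j
  have h0 : 0 < (2 * n).choose j := Nat.choose_pos (by omega)
  by_contra hle
  have h1 : (2 * n).choose (j + 1) * (j + 1) ≤ (2 * n).choose j * (j + 1) :=
    Nat.mul_le_mul_right _ (not_lt.1 hle)
  rw [h] at h1
  have := Nat.le_of_mul_le_mul_left h1 h0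
  omega

theorem multiplicity_pos {n j : ℕ} (hj : j ≤ n) : 0 < multiplicity (2 * n) j := by
  cases j with
  | zero => exact Nat.one_pos
  | succ j => exact Nat.sub_pos_of_lt (choose_pred_lt hj)

theorem sum_multiplicity (n k : ℕ) (hk : k ≤ n) :
    ∑ j ∈ range (k + 1), multiplicity (2 * n) j = (2 * n).choose k := by
  induction k with
  | zero => simp [multiplicity]
  | succ k ih =>
    rw [sum_range_succ, ih (by omega)]
    exact Nat.add_sub_of_le (choose_pred_lt hk).le

theorem hasEigenvalue_chainOperator_iff {n : ℕ} (hn : 1 ≤ n) (μ : ℂ) :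
    (chainOperator n).HasEigenvalue μ ↔ ∃ j ≤ n, μ = (eigenvalue n j : ℂ) := by
  rw [End.hasEigenvalue_iff]
  constructor
  · intro h
    have hn0 : (2 * (n : ℂ) ^ 2) ≠ 0 := by
      have : (n : ℂ) ≠ 0 := by exact_mod_cast (by omega : n ≠ 0)
      simpa using this
    rw [Ne, ← Submodule.finrank_eq_zero, finrank_eigenspace_chainOperator hn,
      Submodule.finrank_eq_zero] at h
    obtain ⟨j, hj, hμ⟩ :=
      (levelEigenspace_spectrum (𝕜 := ℂ) (α := Fin (2 * n)) n (by simp)).2 _ h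
    rw [Fintype.card_fin, levelEigenvalue_eq_eigenvalue hn, sub_left_inj] at hμ
    exact ⟨j, hj, mul_left_cancel₀ hn0 hμ⟩
  · rintro ⟨j, hj, rfl⟩ h
    rw [← Submodule.finrank_eq_zero, finrank_eigenspace_eigenvalue hn hj] at h
    exact (multiplicity_pos hj).ne' h

/-! ### The trace of the powers of the chain -/

theorem eigenvalue_eq {n : ℕ} (hn : 1 ≤ n) (j : ℕ) :
    eigenvalue n j = 1 - j * (2 * n - j + 1) / (2 * n ^ 2) := by
  have : (n : ℝ) ≠ 0 := by exact_mod_cast (by omega : n ≠ 0)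
  simp only [eigenvalue]
  field_simp
  ring

theorem eigenvalue_injOn {n : ℕ} (hn : 1 ≤ n) {i j : ℕ} (hi : i ≤ n) (hj : j ≤ n)
    (h : eigenvalue n i = eigenvalue n j) : i = j := by
  have hn0 : (n : ℝ) ≠ 0 := by exact_mod_cast (by omega : n ≠ 0)
  rw [eigenvalue_eq hn, eigenvalue_eq hn] at h
  field_simp at h
  have h1 : ((i : ℝ) - j) * (2 * n + 1 - i - j) = 0 := by linear_combination -h
  have hi' : (i : ℝ) ≤ n := by exact_mod_cast hi
  have hj' : (j : ℝ) ≤ n := by exact_mod_cast hj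
  have h2 := (mul_eq_zero.1 h1).resolve_right (by linarith)
  exact_mod_cast sub_eq_zero.1 h2

/-- The eigenspaces fill the space by a dimension count: the multiplicities telescope to `C(2n, n)`,
the number of arrangements. -/
theorem isInternal_eigenspace {n : ℕ} (hn : 1 ≤ n) :
    DirectSum.IsInternal fun j : Fin (n + 1) =>
      (chainOperator n).eigenspace (eigenvalue n j : ℂ) := by
  have hind : iSupIndep fun j : Fin (n + 1) =>
      (chainOperator n).eigenspace (eigenvalue n j : ℂ) :=
    (End.eigenspaces_iSupIndep (chainOperator n)).comp fun i j hij =>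
      Fin.ext (eigenvalue_injOn hn (by omega) (by omega) (Complex.ofReal_injective hij))
  have hinj : Function.Injective (DirectSum.coeLinearMap fun j : Fin (n + 1) =>
      (chainOperator n).eigenspace (eigenvalue n j : ℂ)) := hind.dfinsupp_lsum_injective
  refine ⟨hinj, ?_⟩
  refine (LinearMap.injective_iff_surjective_of_finrank_eq_finrank ?_).1 hinj
  rw [Module.finrank_directSum, Module.finrank_fintype_fun_eq_card, card_deck,
    ← sum_multiplicity n n le_rfl, ← Fin.sum_univ_eq_sum_range (multiplicity (2 * n))]
  exact sum_congr rfl fun j _ => finrank_eigenspace_eigenvalue hn (by omega)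

theorem trace_chain_pow {n : ℕ} (hn : 1 ≤ n) (m : ℕ) :
    (chain n ^ m).trace =
      ∑ j ∈ range (n + 1), (multiplicity (2 * n) j : ℝ) * eigenvalue n j ^ m := by
  have hmap : ∀ μ : ℂ, ∀ f ∈ (chainOperator n).eigenspace μ,
      (chainOperator n ^ m) f = μ ^ m • f := by
    intro μ f hf
    rw [End.mem_eigenspace_iff] at hf
    induction m with
    | zero => simp
    | succ m ih => rw [pow_succ, End.mul_apply, hf, map_smul, ih, smul_smul, pow_succ']
  have h := LinearMap.trace_eq_sum_trace_restrict (isInternal_eigenspace hn)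
    (f := chainOperator n ^ m) fun j f hf => by
      have hf' := hmap _ f hf
      rw [SetLike.mem_coe, hf']
      exact Submodule.smul_mem _ _ hf
  have h1 : ∀ j : Fin (n + 1), LinearMap.trace ℂ _ ((chainOperator n ^ m).restrict
      (p := (chainOperator n).eigenspace (eigenvalue n j : ℂ))
      (q := (chainOperator n).eigenspace (eigenvalue n j : ℂ)) fun f hf => by
        rw [hmap _ f hf]
        exact Submodule.smul_mem _ _ hf) =
      (multiplicity (2 * n) j : ℂ) * (eigenvalue n j : ℂ) ^ m := by
    intro j
    rw [← finrank_eigenspace_eigenvalue hn (by omega : (j : ℕ) ≤ n), mul_comm,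
      ← LinearMap.trace_one, ← smul_eq_mul, ← map_smul]
    congr 1
    ext f : 2
    exact hmap _ f f.2
  rw [sum_congr rfl fun j _ => h1 j, Fin.sum_univ_eq_sum_range
    (fun j => (multiplicity (2 * n) j : ℂ) * (eigenvalue n j : ℂ) ^ m)] at h
  have h2 : LinearMap.trace ℂ _ (chainOperator n ^ m) = ((chain n ^ m).trace : ℂ) := by
    rw [chainOperator, ← Matrix.toLin'_pow, Matrix.trace_toLin'_eq]
    have : (chain n).map Complex.ofReal ^ m = (chain n ^ m).map Complex.ofReal :=
      (map_pow (Complex.ofRealHom.mapMatrix) (chain n) m).symm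
    rw [this]
    simp [Matrix.trace]
  rw [h2] at h
  exact_mod_cast h

/-! ### The total variation distance and the trace -/

theorem chain_pow_smul (n m : ℕ) (g : Equiv.Perm (Fin (2 * n))) (x y : Deck n) :
    (chain n ^ m) (g • x) (g • y) = (chain n ^ m) x y := by
  induction m generalizing y with
  | zero => simp [Matrix.one_apply]
  | succ m ih =>
    rw [pow_succ, Matrix.mul_apply, Matrix.mul_apply, ← Equiv.sum_comp (MulAction.toPerm g)]
    simp only [MulAction.toPerm_apply, ih, chain_smul]

theorem sum_chain_pow {n : ℕ} (hn : 1 ≤ n) (m : ℕ) (x : Deck n) :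
    ∑ y, (chain n ^ m) x y = 1 := by
  induction m with
  | zero => simp [Matrix.one_apply]
  | succ m ih =>
    simp only [pow_succ, Matrix.mul_apply]
    rw [sum_comm]
    simp only [← mul_sum, sum_chain hn, mul_one, ih]

theorem chain_pow_nonneg (n m : ℕ) (x y : Deck n) : 0 ≤ (chain n ^ m) x y := by
  induction m generalizing y with
  | zero => rw [pow_zero, Matrix.one_apply]; split_ifs <;> norm_num
  | succ m ih =>
    rw [pow_succ, Matrix.mul_apply]
    exact sum_nonneg fun z _ => mul_nonneg (ih z) (chain_nonneg n z y)

/-- By transitivity of the symmetric group all diagonal entries of a power agree. -/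
theorem card_mul_chain_pow (n m : ℕ) (x : Deck n) :
    (Fintype.card (Deck n) : ℝ) * (chain n ^ m) x x = (chain n ^ m).trace := by
  rw [← nsmul_eq_mul, ← card_univ, ← sum_const, Matrix.trace]
  refine sum_congr rfl fun y _ => ?_
  obtain ⟨g, rfl⟩ := MulAction.exists_smul_eq (Equiv.Perm (Fin (2 * n))) x y
  exact (chain_pow_smul n m g x x).symm

/-- The `L²` bound for the distance to uniformity. As the chain is symmetric and invariant under
a transitive group, the `L²` distance is read off from the trace of `K ^ (2 * l)`. -/
theorem four_mul_tvDist_sq_le {n : ℕ} (hn : 1 ≤ n) (l : ℕ) (x : Deck n) :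
    4 * tvDist ((chain n ^ l) x) (uniform (Deck n)) ^ 2 ≤
      ∑ j ∈ Icc 1 n, (multiplicity (2 * n) j : ℝ) * eigenvalue n j ^ (2 * l) := by
  have hcs := sq_sum_le_card_mul_sum_sq (s := (univ : Finset (Deck n)))
    (f := fun y => |(chain n ^ l) x y - uniform (Deck n) y|)
  have hX : (Fintype.card (Deck n) : ℝ) ≠ 0 := by
    rw [card_deck]
    exact_mod_cast (Nat.choose_pos (by omega)).ne'
  have hsq : ∑ y, (chain n ^ l) x y ^ 2 = (chain n ^ (2 * l)) x x := by
    have hs : (chain n ^ l).IsSymm := by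
      apply Matrix.IsSymm.pow
      ext x y
      exact chain_symm n y x
    rw [two_mul l, pow_add, Matrix.mul_apply]
    exact sum_congr rfl fun y _ => by rw [sq, hs.apply x y]
  have htr : (Fintype.card (Deck n) : ℝ) * (chain n ^ (2 * l)) x x =
      1 + ∑ j ∈ Icc 1 n, (multiplicity (2 * n) j : ℝ) * eigenvalue n j ^ (2 * l) := by
    rw [card_mul_chain_pow, trace_chain_pow hn, range_eq_Ico, sum_eq_sum_Ico_succ_bot (by omega),
      eigenvalue_zero hn]
    simp [multiplicity]
    rfl
  calc 4 * tvDist ((chain n ^ l) x) (uniform (Deck n)) ^ 2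
      = (∑ y, |(chain n ^ l) x y - uniform (Deck n) y|) ^ 2 := by rw [tvDist]; ring
    _ ≤ Fintype.card (Deck n) * ∑ y, |(chain n ^ l) x y - uniform (Deck n) y| ^ 2 := hcs
    _ = Fintype.card (Deck n) * (chain n ^ (2 * l)) x x - 1 := by
      simp only [sq_abs, sub_sq, sum_add_distrib, sum_sub_distrib, hsq, uniform, mul_assoc,
        ← mul_sum, ← sum_mul, sum_chain_pow hn, sum_const, card_univ, nsmul_eq_mul]
      field_simp
      ring
    _ = _ := by rw [htr]; ring

theorem tvDist_le_one {n : ℕ} (hn : 1 ≤ n) (l : ℕ) (x : Deck n) :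
    tvDist ((chain n ^ l) x) (uniform (Deck n)) ≤ 1 := by
  have h : ∑ y, |(chain n ^ l) x y - uniform (Deck n) y| ≤
      ∑ y, ((chain n ^ l) x y + uniform (Deck n) y) := by
    refine sum_le_sum fun y _ => ?_
    have h1 := chain_pow_nonneg n l x y
    have h2 : 0 ≤ uniform (Deck n) y := by unfold uniform; positivity
    rw [abs_le]
    constructor <;> linarith
  have hX : (Fintype.card (Deck n) : ℝ) ≠ 0 := by
    rw [card_deck]
    exact_mod_cast (Nat.choose_pos (by omega)).ne'
  rw [sum_add_distrib, sum_chain_pow hn] at h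
  have h3 : ∑ y, uniform (Deck n) y = 1 := by simp [uniform, hX]
  rw [tvDist]
  linarith

/-! ### Estimates of the terms -/

/-- For `1 ≤ j ≤ n`, `N ^ (j * (j - 1) / N) ≤ (2 * j) ^ ((j - 1) / 2)` in logarithmic form: the
function `log x / x` decreases for `x ≥ e`. -/
theorem mul_log_le {n j : ℕ} (hj : 1 ≤ j) (hjn : j ≤ n) :
    (j : ℝ) * (j - 1) / (2 * n) * Real.log (2 * n) ≤ (j - 1) / 2 * Real.log (2 * j) := by
  rcases hj.eq_or_lt with rfl | hj
  · simp
  have hj2 : (2 : ℝ) ≤ j := by exact_mod_cast hj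
  have hn : (j : ℝ) ≤ n := by exact_mod_cast hjn
  have he : Real.exp 1 ≤ 2 * j := by linarith [Real.exp_one_lt_d9]
  have h := Real.log_div_self_antitoneOn (Set.mem_Ici.2 he)
    (Set.mem_Ici.2 (he.trans (by linarith : (2 : ℝ) * j ≤ 2 * n))) (by linarith)
  calc (j : ℝ) * (j - 1) / (2 * n) * Real.log (2 * n)
      = j * (j - 1) * (Real.log (2 * n) / (2 * n)) := by ring
    _ ≤ j * (j - 1) * (Real.log (2 * j) / (2 * j)) :=
      mul_le_mul_of_nonneg_left h (mul_nonneg (by linarith) (by linarith))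
    _ = (j - 1) / 2 * Real.log (2 * j) := by field_simp

/-- The square of `(2j)^{(j-1)/2} / j!` is at most `(2j)^j / (j!)² ≤ (2e)^j / j!`; the
arithmetic-geometric mean inequality removes the root. -/
theorem exp_div_factorial_le {j : ℕ} (hj : 1 ≤ j) :
    Real.exp ((j - 1) / 2 * Real.log (2 * j)) / j.factorial ≤
      (4 * Real.exp 1) ^ j / j.factorial + (1 / 2) ^ j := by
  have hj1 : (1 : ℝ) ≤ j := by exact_mod_cast hj
  have hf : (0 : ℝ) < j.factorial := by exact_mod_cast j.factorial_pos
  set t := Real.exp ((j - 1) / 2 * Real.log (2 * j)) / j.factorial with ht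
  have ht0 : 0 ≤ t := by positivity
  set u := (4 * Real.exp 1) ^ j / (j.factorial : ℝ) with hu
  have hu0 : 0 ≤ u := by positivity
  set v := ((1 : ℝ) / 2) ^ j with hv
  have hv0 : 0 ≤ v := by positivity
  have h1 : Real.exp ((j - 1) / 2 * Real.log (2 * j)) ^ 2 ≤ (2 * j : ℝ) ^ j := by
    rw [← Real.exp_nat_mul]
    have h2 : Real.exp (j * Real.log (2 * j)) = (2 * j : ℝ) ^ j := by
      rw [Real.exp_nat_mul, Real.exp_log (by positivity)]
    rw [← h2]
    have h3 : 0 ≤ Real.log (2 * j) := Real.log_nonneg (by linarith)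
    refine Real.exp_le_exp.2 ?_
    push_cast
    nlinarith
  have h2 : (j : ℝ) ^ j / j.factorial ≤ Real.exp 1 ^ j := by
    rw [← Real.exp_nat_mul, mul_one]
    exact Real.pow_div_factorial_le_exp _ (by positivity) j
  have h3 : t ^ 2 ≤ u * v := by
    calc t ^ 2 ≤ (2 * j : ℝ) ^ j / j.factorial ^ 2 := by rw [ht, div_pow]; gcongr
      _ = 2 ^ j * ((j : ℝ) ^ j / j.factorial) / j.factorial := by rw [mul_pow]; field_simp
      _ ≤ 2 ^ j * Real.exp 1 ^ j / j.factorial := by gcongr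
      _ = u * v := by
        rw [hu, hv, mul_pow, one_div, inv_pow, (by norm_num : (4 : ℝ) = 2 * 2), mul_pow]
        field_simp
  nlinarith [sq_nonneg (u - v)]

theorem eigenvalue_nonneg {n j : ℕ} (hn : 1 ≤ n) (hj : j ≤ n) : 0 ≤ eigenvalue n j := by
  have hn1 : (1 : ℝ) ≤ n := by exact_mod_cast hn
  have hj1 : (j : ℝ) ≤ n := by exact_mod_cast hj
  rw [eigenvalue_eq hn, sub_nonneg, div_le_one (by positivity)]
  nlinarith [Nat.cast_nonneg (α := ℝ) j]

theorem multiplicity_le (n : ℕ) {j : ℕ} (hj : 1 ≤ j) :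
    (multiplicity (2 * n) j : ℝ) ≤ (2 * n : ℝ) ^ j / j.factorial := by
  obtain ⟨j, rfl⟩ : ∃ i, j = i + 1 := ⟨j - 1, by omega⟩
  have h : multiplicity (2 * n) (j + 1) ≤ (2 * n).choose (j + 1) := Nat.sub_le _ _
  have h2 := Nat.choose_le_pow_div (α := ℝ) (j + 1) (2 * n)
  push_cast at h2
  exact le_trans (by exact_mod_cast h) h2

/-- Each term of the trace is dominated by a term of a convergent series not depending on `n`, times
`exp (-c)`. -/
theorem multiplicity_mul_eigenvalue_pow_le {n j l : ℕ} (hj : 1 ≤ j) (hjn : j ≤ n) {c : ℝ}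
    (hc : 0 ≤ c) (hl : 1 / 4 * (2 * n : ℝ) * (Real.log (2 * n : ℝ) + c) ≤ l) :
    (multiplicity (2 * n) j : ℝ) * eigenvalue n j ^ (2 * l) ≤
      ((4 * Real.exp 1) ^ j / j.factorial + (1 / 2) ^ j) * Real.exp (-c) := by
  have hn : 1 ≤ n := hj.trans hjn
  have hn1 : (1 : ℝ) ≤ n := by exact_mod_cast hn
  have hj1 : (1 : ℝ) ≤ j := by exact_mod_cast hj
  have hjn1 : (j : ℝ) ≤ n := by exact_mod_cast hjn
  set L := Real.log (2 * n) with hL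
  have hf : (0 : ℝ) < j.factorial := by exact_mod_cast j.factorial_pos
  set q : ℝ := j * (2 * n - j + 1) with hq
  -- `j * (N - j + 1)` increases for `j ≤ n`, and it is `N` at `j = 1`.
  have hq0 : 2 * n ≤ q := by nlinarith
  have h1 : eigenvalue n j ^ (2 * l) ≤ Real.exp (-(q / (2 * n)) * (L + c)) := by
    calc eigenvalue n j ^ (2 * l) ≤ Real.exp (-(q / (2 * n ^ 2))) ^ (2 * l) := by
          refine pow_le_pow_left₀ (eigenvalue_nonneg hn hjn) ?_ _
          rw [eigenvalue_eq hn]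
          exact Real.one_sub_le_exp_neg _
      _ = Real.exp (-(q / n ^ 2) * l) := by
          rw [← Real.exp_nat_mul]
          congr 1
          push_cast
          field_simp
      _ ≤ Real.exp (-(q / n ^ 2) * (1 / 4 * (2 * n : ℝ) * (L + c))) := by
          have : 0 ≤ q / (n : ℝ) ^ 2 := by
            have : 0 ≤ q := by linarith
            positivity
          rw [neg_mul, neg_mul]
          exact Real.exp_le_exp.2 (neg_le_neg (mul_le_mul_of_nonneg_left hl this))
      _ = Real.exp (-(q / (2 * n)) * (L + c)) := by
          congr 1
          field_simp
          ring
  have h2 : (2 * n : ℝ) ^ j = Real.exp (j * L) := by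
    rw [Real.exp_nat_mul, hL, Real.exp_log (by positivity)]
  have h3 : j * L + -(q / (2 * n)) * (L + c) ≤ (j - 1) / 2 * Real.log (2 * j) + -c := by
    have h4 := mul_log_le hj hjn
    have h5 : j * L + -(q / (2 * n)) * (L + c) =
        j * (j - 1) / (2 * n) * L - q / (2 * n) * c := by
      rw [hq]
      field_simp
      ring
    have h6 : 1 ≤ q / (2 * n) := (one_le_div (by positivity)).2 hq0
    nlinarith
  calc (multiplicity (2 * n) j : ℝ) * eigenvalue n j ^ (2 * l)
      ≤ (2 * n : ℝ) ^ j / j.factorial * Real.exp (-(q / (2 * n)) * (L + c)) :=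
        mul_le_mul (multiplicity_le n hj) h1 (by rw [pow_mul]; positivity) (by positivity)
    _ = Real.exp (j * L + -(q / (2 * n)) * (L + c)) / j.factorial := by
        rw [h2, Real.exp_add]; ring
    _ ≤ Real.exp ((j - 1) / 2 * Real.log (2 * j) + -c) / j.factorial := by gcongr
    _ = Real.exp ((j - 1) / 2 * Real.log (2 * j)) / j.factorial * Real.exp (-c) := by
        rw [Real.exp_add]; ring
    _ ≤ _ := by gcongr; exact exp_div_factorial_le hj

theorem summable_majorant :
    Summable fun j : ℕ => (4 * Real.exp 1) ^ j / (j.factorial : ℝ) + (1 / 2) ^ j :=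
  (Real.summable_pow_div_factorial _).add summable_geometric_two

theorem exists_tvDist_le : ∃ A : ℝ, ∀ n : ℕ, 1 ≤ n → ∀ (c : ℝ) (l : ℕ),
    1 / 4 * (2 * n : ℝ) * (Real.log (2 * n : ℝ) + c) ≤ (l : ℝ) →
    ∀ x : Deck n, tvDist ((chain n ^ l) x) (uniform (Deck n)) ≤ A * Real.exp (-c / 2) := by
  set S := ∑' j : ℕ, ((4 * Real.exp 1) ^ j / (j.factorial : ℝ) + (1 / 2) ^ j) with hS
  have hS0 : 0 ≤ S := tsum_nonneg fun j => by positivity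
  refine ⟨1 + S, fun n hn c l hl x => ?_⟩
  rcases lt_or_ge c 0 with hc | hc
  -- For negative `c` the bound exceeds the trivial bound `1`.
  · have h1 : 1 ≤ Real.exp (-c / 2) := Real.one_le_exp (by linarith)
    have := tvDist_le_one hn l x
    nlinarith
  · have h := four_mul_tvDist_sq_le hn l x
    have h1 : ∑ j ∈ Icc 1 n, (multiplicity (2 * n) j : ℝ) * eigenvalue n j ^ (2 * l) ≤
        S * Real.exp (-c) := by
      refine (sum_le_sum fun j hj => multiplicity_mul_eigenvalue_pow_le (mem_Icc.1 hj).1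
        (mem_Icc.1 hj).2 hc hl).trans ?_
      rw [← sum_mul]
      gcongr
      exact summable_majorant.sum_le_tsum _ fun j _ => by positivity
    have h2 : Real.exp (-c) = Real.exp (-c / 2) ^ 2 := by
      rw [← Real.exp_nat_mul]
      congr 1
      push_cast
      ring
    rw [h2] at h1
    refine le_of_sq_le_sq ?_ (by positivity)
    nlinarith [sq_nonneg (Real.exp (-c / 2)), sq_nonneg (S * Real.exp (-c / 2)),
      mul_nonneg hS0 (sq_nonneg (Real.exp (-c / 2)))]

end RedBlack

theorem mainTheorem12 :
    (∀ n : ℕ, 1 ≤ n →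
      (∀ μ : ℂ, (RedBlack.chainOperator n).HasEigenvalue μ ↔
        μ = 1 ∨ ∃ j ∈ Finset.Icc 1 n, μ = (RedBlack.eigenvalue n j : ℂ)) ∧
      Module.finrank ℂ ((RedBlack.chainOperator n).eigenspace 1) = 1 ∧
      ∀ j ∈ Finset.Icc 1 n,
        (Module.finrank ℂ
            ((RedBlack.chainOperator n).eigenspace (RedBlack.eigenvalue n j : ℂ)) : ℤ) =
          ((2 * n).choose j : ℤ) - ((2 * n).choose (j - 1) : ℤ)) ∧
    ∃ A : ℝ, ∀ n : ℕ, 1 ≤ n → ∀ (c : ℝ) (l : ℕ),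
      1 / 4 * (2 * n : ℝ) * (Real.log (2 * n : ℝ) + c) ≤ (l : ℝ) →
      ∀ x : RedBlack.Deck n,
        RedBlack.tvDist ((RedBlack.chain n ^ l) x) (RedBlack.uniform (RedBlack.Deck n)) ≤
          A * Real.exp (-c / 2) := by
  refine ⟨fun n hn => ⟨fun μ => ?_, ?_, fun j hj => ?_⟩, RedBlack.exists_tvDist_le⟩
  · rw [RedBlack.hasEigenvalue_chainOperator_iff hn]
    constructor
    · rintro ⟨j, hj, rfl⟩
      rcases Nat.eq_zero_or_pos j with rfl | hj0
      · left
        rw [RedBlack.eigenvalue_zero hn, Complex.ofReal_one]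
      · exact Or.inr ⟨j, Finset.mem_Icc.2 ⟨hj0, hj⟩, rfl⟩
    · rintro (rfl | ⟨j, hj, rfl⟩)
      · exact ⟨0, by omega, by rw [RedBlack.eigenvalue_zero hn, Complex.ofReal_one]⟩
      · exact ⟨j, (Finset.mem_Icc.1 hj).2, rfl⟩
  · have h := RedBlack.finrank_eigenspace_eigenvalue hn (Nat.zero_le n)
    rwa [RedBlack.eigenvalue_zero hn, Complex.ofReal_one] at h
  · obtain ⟨h1, h2⟩ := Finset.mem_Icc.1 hj
    obtain ⟨i, rfl⟩ : ∃ i, j = i + 1 := ⟨j - 1, by omega⟩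
    rw [RedBlack.finrank_eigenspace_eigenvalue hn h2, RedBlack.multiplicity,
      Nat.cast_sub (RedBlack.choose_pred_lt h2).le, Nat.add_sub_cancel]
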